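/- \textbf{Setting.} Let $P$ be a probability measure on $\mathbb{R}^d$ with a Lebesgue density $p\in\mathcal{C}^1$, $p>0$ everywhere, and score $\mathbf{s}_p=\nabla\log p$. Let $k(\mathbf{x},\mathbf{x}')=w(\mathbf{x})\,h(\mathbf{x}-\mathbf{x}')\,w(\mathbf{x}')$, where $(\mathbf{x},\mathbf{x}')\mapsto h(\mathbf{x}-\mathbf{x}')$ is a reproducing (symmetric positive semidefinite) kernel, $h$ is $\mathcal{C}^2$ and bounded with bounded gradient and bounded Laplacian, $w$ is $\mathcal{C}^1$ and bounded with bounded gradient, and $\sup_{\mathbf{x}}\|w(\mathbf{x})\mathbf{s}_p(\mathbf{x})\|_2<\infty$. Let $\mathcal{H}_k$ be the reproducing kernel Hilbert space of $k$. For a probability measure $Q$ on $\mathbb{R}^d$ put $$D(Q,P)=\sup\Big\{\big|\mathbb{E}_{\mathbf{X}\sim Q}[\mathbf{s}_p(\mathbf{X})^\top f(\mathbf{X})+\nabla^\top f(\mathbf{X})]\big| : f=(f_1,\dots,f_d),\ f_j\in\mathcal{H}_k,\ \textstyle\sum_j\|f_j\|_{\mathcal{H}_k}^2\le 1\Big\},$$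 and for $\theta\ge 0$ let $\mathcal{B}^{\mathrm{KSD}}(P;\theta)=\{Q: D(Q,P)\le\theta\}$. Let $$u_p(\mathbf{x},\mathbf{x}')=\mathbf{s}_p(\mathbf{x})^\top\mathbf{s}_p(\mathbf{x}')k(\mathbf{x},\mathbf{x}')+\mathbf{s}_p(\mathbf{x})^\top\nabla_2k(\mathbf{x},\mathbf{x}')+\nabla_1k(\mathbf{x},\mathbf{x}')^\top\mathbf{s}_p(\mathbf{x}')+\nabla_1^\top\nabla_2k(\mathbf{x},\mathbf{x}')$$ and $\tau_\infty=\sup_{\mathbf{x}}u_p(\mathbf{x},\mathbf{x})$. For $\mathbb{X}_n=(\mathbf{X}_1,\dots,\mathbf{X}_n)$ put $D(\mathbb{X}_n)=\big(n^{-2}\sum_{i,j=1}^n u_p(\mathbf{X}_i,\mathbf{X}_j)\big)^{1/2}$ and $\Delta_\theta(\mathbb{X}_n)=\max(0,D(\mathbb{X}_n)-\theta)$. For $\alpha\in(0,1)$ put $\gamma_n=\sqrt{\tau_\infty/n}+\sqrt{-2\tau_\infty\log\alpha/n}$. Write $\Pr_{\mathbb{X}_n\sim Q}$ for the probability when $\mathbf{X}_1,\dots,\mathbf{X}_n$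 are independent with law $Q$. \textbf{Theorem.} Under these assumptions $\tau_\infty<\infty$ and, for every probability measure $Q$ on $\mathbb{R}^d$, all expectations in the definition of $D(Q,P)$ exist. For every $\theta\ge0$ and $\alpha\in(0,1)$: \begin{enumerate} \item for every $n\ge1$, $\displaystyle\sup_{Q\in\mathcal{B}^{\mathrm{KSD}}(P;\theta)}\Pr_{\mathbb{X}_n\sim Q}\big(\Delta_\theta(\mathbb{X}_n)>\gamma_n\big)\le\alpha$; \item for every probability measure $Q\notin\mathcal{B}^{\mathrm{KSD}}(P;\theta)$, $\Pr_{\mathbb{X}_n\sim Q}\big(\Delta_\theta(\mathbb{X}_n)>\gamma_n\big)\to1$ as $n\to\infty$. \end{enumerate} -/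

import Mathlib

namespace RobustKSD

noncomputable section

open MeasureTheory
open scoped ENNReal

/-- `ℝ^d` with its Euclidean norm. -/
abbrev Euc (d : ℕ) : Type := EuclideanSpace ℝ (Fin d)

variable {d : ℕ}

/-- `f ∈ C_b^1`: continuously differentiable, bounded, with bounded gradient. -/
def IsCb1 (f : Euc d → ℝ) : Prop :=
  ContDiff ℝ 1 f ∧ (∃ C, ∀ x, |f x| ≤ C) ∧ ∃ C, ∀ x, ‖gradient f x‖ ≤ C

/-- `f ∈ C_b^2`: twice continuously differentiable, in `C_b^1`, with bounded Laplacian. -/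
def IsCb2 (f : Euc d → ℝ) : Prop :=
  ContDiff ℝ 2 f ∧ IsCb1 f ∧ ∃ C, ∀ x, |Laplacian.laplacian f x| ≤ C

/-- `k` is a (real, scalar-valued) reproducing kernel, i.e. symmetric and positive
semidefinite. -/
def IsReproducingKernel (k : Euc d → Euc d → ℝ) : Prop :=
  (∀ x y, k x y = k y x) ∧
    ∀ (s : Finset (Euc d)) (c : Euc d → ℝ), 0 ≤ ∑ x ∈ s, ∑ y ∈ s, c x * c y * k x y

/-- The tilted kernel `k(x, x') = w(x) h(x - x') w(x')`. -/
def tiltedKernel (w h : Euc d → ℝ) (x x' : Euc d) : ℝ := w x * h (x - x') * w x'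

/-- The score function `s_p = ∇ log p`. -/
def score (p : Euc d → ℝ) (x : Euc d) : Euc d := gradient (fun y => Real.log (p y)) x

/-- The Langevin Stein operator `(A_p f)(x) = s_p(x)ᵀ f(x) + ∇ᵀ f(x)`
at a vector field `f = (f_1, …, f_d)`. -/
def langevinStein (p : Euc d → ℝ) (f : Fin d → Euc d → ℝ) (x : Euc d) : ℝ :=
  ∑ j, score p x j * f j x + ∑ j, gradient (f j) x j

/-- The Stein kernel
`u_p(x, x') = s_p(x)ᵀ s_p(x') k(x, x') + s_p(x)ᵀ ∇₂ k(x, x') + ∇₁ k(x, x')ᵀ s_p(x') + ∇₁ᵀ∇₂ k(x, x')`,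
with `∇₁ᵀ∇₂ k = ∑ j, ∂_{1j} ∂_{2j} k`. -/
def steinKernel (p : Euc d → ℝ) (k : Euc d → Euc d → ℝ) (x x' : Euc d) : ℝ :=
  inner ℝ (score p x) (score p x') * k x x'
    + inner ℝ (score p x) (gradient (fun y' => k x y') x')
    + inner ℝ (gradient (fun y => k y x') x) (score p x')
    + ∑ j, gradient (fun y => gradient (fun y' => k y y') x' j) x j

/-- `τ_∞ = sup_x u_p(x, x)`. -/
def tauInf (p : Euc d → ℝ) (k : Euc d → Euc d → ℝ) : ℝ := ⨆ x, steinKernel p k x x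

section KSD

variable (H : Type*) [NormedAddCommGroup H] [InnerProductSpace ℝ H] [RKHS ℝ H (Euc d) ℝ]

/-- The unit ball of the `d`-fold product `H^d` of the Hilbert space of functions `H`. -/
def unitBall : Set (Fin d → H) := {f | ∑ j, ‖f j‖ ^ 2 ≤ 1}

/-- The Langevin kernel Stein discrepancy
`D(Q, P) = sup_{f ∈ unit ball of H^d} |E_{X ∼ Q} (A_p f)(X)|`, as an extended nonnegative real;
`p` is the density of `P`. -/
def ksd (p : Euc d → ℝ) (Q : Measure (Euc d)) : ℝ≥0∞ :=
  ⨆ f ∈ unitBall (d := d) H, ‖∫ x, langevinStein p (fun j => ⇑(f j)) x ∂Q‖ₑ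

/-- The KSD ball `{Q : D(Q, P) ≤ θ}`. -/
def ksdBall (p : Euc d → ℝ) (θ : ℝ) : Set (ProbabilityMeasure (Euc d)) :=
  {Q | ksd H p (Q : Measure (Euc d)) ≤ ENNReal.ofReal θ}

end KSD

/-- `D(X_n)`, the square root of the V-statistic `n⁻² ∑_{i,j} u_p(X_i, X_j)`. -/
def ksdStat (p : Euc d → ℝ) (k : Euc d → Euc d → ℝ) {n : ℕ} (X : Fin n → Euc d) : ℝ :=
  √(1 / (n : ℝ) ^ 2 * ∑ i, ∑ j, steinKernel p k (X i) (X j))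

/-- The robust test statistic `Δ_θ(X_n) = max(0, D(X_n) - θ)`. -/
def robustStat (p : Euc d → ℝ) (k : Euc d → Euc d → ℝ) (θ : ℝ) {n : ℕ} (X : Fin n → Euc d) : ℝ :=
  max 0 (ksdStat p k X - θ)

/-- The threshold `γ_n = √(τ_∞ / n) + √(-2 τ_∞ log α / n)`. -/
def threshold (p : Euc d → ℝ) (k : Euc d → Euc d → ℝ) (α : ℝ) (n : ℕ) : ℝ :=
  √(tauInf p k / n) + √(-2 * tauInf p k * Real.log α / n)

/-- The rejection probability `Pr_{X_n ∼ Q}(Δ_θ(X_n) > γ_n)` for `X_1, …, X_n` i.i.d. from `Q`. -/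
def rejectionProb (p : Euc d → ℝ) (k : Euc d → Euc d → ℝ) (θ α : ℝ) (n : ℕ)
    (Q : ProbabilityMeasure (Euc d)) : ℝ≥0∞ :=
  Measure.pi (fun _ : Fin n => (Q : Measure (Euc d)))
    {X | robustStat p k θ X > threshold p k α n}

end

end RobustKSD

/-! The test compares the norms of two Hilbert-space means. Smoothness of the kernel makes its
feature map Lipschitz, so every element of H is differentiable and its partial derivatives at a
point are bounded functionals. By Riesz, the Stein operator at x is then the inner product with a
vector ξ(x) of H^d, whose Gram kernel is u_p and which is bounded because w tames the score
(`exists_stein_feature`).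

Hence τ_∞ = sup ‖ξ‖², D(Q, P) = ‖E_Q ξ‖ (`ksd_eq_enorm_integral`) and D(X_n) is the norm of the
empirical mean of ξ (`ksdStat_eq_norm`). By the triangle inequality these differ by at most the
deviation ‖n⁻¹ ∑ ξ(X_i) - E_Q ξ‖.

The two terms of γ_n control this deviation: its expectation is at most √(τ_∞/n) by a variance
computation, and McDiarmid's inequality bounds its excess over that expectation at level α
(`measure_lt_meanDeviation_le`). Outside the ball the gap D(Q, P) - θ is a fixed positive number,
while γ_n tends to 0 and Chebyshev's inequality makes the deviation negligible. -/

namespace RobustKSD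

open MeasureTheory Filter ProbabilityTheory
open scoped ENNReal NNReal Topology

/-! ### Differentiability of RKHS elements and Riesz representers of derivatives -/

section Differentiability

variable {E : Type*} [NormedAddCommGroup E] [NormedSpace ℝ E]
variable {H : Type*} [NormedAddCommGroup H] [InnerProductSpace ℝ H] [CompleteSpace H]
  [RKHS ℝ H E ℝ]

omit [NormedAddCommGroup E] [NormedSpace ℝ E] in
/-- The reproducing property for the scalar kernel sections. -/
lemma inner_kerFun_one (x : E) (f : H) : inner ℝ (RKHS.kerFun H x (1 : ℝ)) f = f x := by
  simp

omit [NormedSpace ℝ E] in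
/-- Elements of an RKHS with a Lipschitz feature map are Lipschitz. -/
lemma lipschitzWith_of_kerFun {L : NNReal}
    (hL : ∀ x y : E, ‖RKHS.kerFun H x (1 : ℝ) - RKHS.kerFun H y (1 : ℝ)‖ ≤ L * ‖x - y‖) (f : H) :
    LipschitzWith (L * ‖f‖₊) f := by
  refine LipschitzWith.of_dist_le_mul fun x y => ?_
  rw [dist_eq_norm, dist_eq_norm, ← inner_kerFun_one x f, ← inner_kerFun_one y f,
    ← inner_sub_left]
  calc _ ≤ ‖RKHS.kerFun H x (1 : ℝ) - RKHS.kerFun H y (1 : ℝ)‖ * ‖f‖ := norm_inner_le_norm _ _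
    _ ≤ (L * ‖x - y‖) * ‖f‖ := by gcongr; exact hL x y
    _ = _ := by push_cast; ring

lemma norm_fderiv_le_of_kerFun {L : NNReal}
    (hL : ∀ x y : E, ‖RKHS.kerFun H x (1 : ℝ) - RKHS.kerFun H y (1 : ℝ)‖ ≤ L * ‖x - y‖) (f : H)
    (x : E) : ‖fderiv ℝ f x‖ ≤ L * ‖f‖ := by
  simpa using norm_fderiv_le_of_lipschitz ℝ (lipschitzWith_of_kerFun hL f) (x₀ := x)

/-- If the feature map is Lipschitz and all kernel sections are differentiable, then every element
of the RKHS is differentiable. -/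
lemma differentiable_of_kerFun {L : NNReal}
    (hL : ∀ x y : E, ‖RKHS.kerFun H x (1 : ℝ) - RKHS.kerFun H y (1 : ℝ)‖ ≤ L * ‖x - y‖)
    (hd : ∀ y : E, Differentiable ℝ (RKHS.kerFun H y (1 : ℝ))) (f : H) :
    Differentiable ℝ f := by
  -- The differentiable elements form a subspace containing the kernel sections, hence a dense one.
  -- Norm convergence forces uniform convergence of derivatives, so differentiability passes to the
  -- limit.
  let S : Submodule ℝ H :=
    { carrier := {f | Differentiable ℝ f}
      add_mem' := fun {a b} ha hb => by
        simp only [Set.mem_ofPred_eq, RKHS.coe_add] at *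
        exact ha.add hb
      zero_mem' := by simp only [Set.mem_ofPred_eq, RKHS.coe_zero]; exact differentiable_const _
      smul_mem' := fun c a ha => by
        simp only [Set.mem_ofPred_eq, RKHS.coe_smul] at *
        exact ha.const_smul c }
  have hS : Submodule.span ℝ {RKHS.kerFun H x v | (x : E) (v : ℝ)} ≤ S := by
    rw [Submodule.span_le]
    rintro _ ⟨x, v, rfl⟩
    have : RKHS.kerFun H x v = v • RKHS.kerFun H x (1 : ℝ) := by
      rw [← map_smul]; simp
    rw [this]
    exact S.smul_mem v (hd x)
  have hf : f ∈ closure (S : Set H) := by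
    have h1 : f ∈ (Submodule.span ℝ {RKHS.kerFun H x v | (x : E) (v : ℝ)}).topologicalClosure := by
      rw [RKHS.kerFun_dense]; trivial
    exact closure_mono hS h1
  obtain ⟨u, huS, hu⟩ := mem_closure_iff_seq_limit.1 hf
  have hud : ∀ n, Differentiable ℝ (u n) := huS
  have hdist : ∀ n m x, dist (fderiv ℝ (u n) x) (fderiv ℝ (u m) x) ≤ L * ‖u n - u m‖ := by
    intro n m x
    have := norm_fderiv_le_of_kerFun hL (u n - u m) x
    rwa [RKHS.coe_sub, fderiv_sub (hud n x) (hud m x), ← dist_eq_norm] at this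
  have hlim : ∀ x, ∃ g, Tendsto (fun n => fderiv ℝ (u n) x) atTop (𝓝 g) := by
    intro x
    apply cauchySeq_tendsto_of_complete
    rw [Metric.cauchySeq_iff']
    intro ε hε
    -- L + 1 rather than L, since L may be 0.
    obtain ⟨N, hN⟩ := Metric.cauchySeq_iff'.1 hu.cauchySeq (ε / (L + 1)) (by positivity)
    refine ⟨N, fun n hn => (hdist n N x).trans_lt ?_⟩
    have := hN n hn
    rw [dist_eq_norm, lt_div_iff₀ (by positivity)] at this
    nlinarith [norm_nonneg (u n - u N)]
  choose g hg using hlim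
  have hunif : TendstoUniformly (fun n x => fderiv ℝ (u n) x) g atTop := by
    have hbd : ∀ n x, dist (g x) (fderiv ℝ (u n) x) ≤ L * ‖u n - f‖ := by
      intro n x
      rw [dist_comm]
      refine le_of_tendsto_of_tendsto (tendsto_const_nhds.dist (hg x))
        ((tendsto_const_nhds.sub hu).norm.const_mul (L : ℝ)) (Eventually.of_forall fun m => ?_)
      exact hdist n m x
    rw [Metric.tendstoUniformly_iff]
    intro ε hε
    have h0 : Tendsto (fun n => (L : ℝ) * ‖u n - f‖) atTop (𝓝 0) := by
      simpa using (tendsto_iff_norm_sub_tendsto_zero.1 hu).const_mul (L : ℝ)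
    filter_upwards [h0.eventually (gt_mem_nhds hε)] with n hn x
    exact (hbd n x).trans_lt hn
  intro x
  refine (hasFDerivAt_of_tendstoUniformly hunif (fun n y => (hud n y).hasFDerivAt)
    (fun y => ?_) x).differentiableAt
  exact ((RKHS.continuous_eval y).tendsto f).comp hu

/-- Derivative evaluation on an RKHS of differentiable functions with Lipschitz feature map is
represented by a bounded family of elements. -/
lemma exists_fderiv_representer {L : NNReal}
    (hL : ∀ x y : E, ‖RKHS.kerFun H x (1 : ℝ) - RKHS.kerFun H y (1 : ℝ)‖ ≤ L * ‖x - y‖)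
    (hd : ∀ f : H, Differentiable ℝ f) (x v : E) :
    ∃ ψ : H, (∀ f : H, inner ℝ ψ f = fderiv ℝ f x v) ∧ ‖ψ‖ ≤ L * ‖v‖ := by
  let ℓ : H →ₗ[ℝ] ℝ :=
    { toFun := fun f => fderiv ℝ f x v
      map_add' := fun a b => by
        rw [RKHS.coe_add, fderiv_add (hd a x) (hd b x)]; rfl
      map_smul' := fun c a => by
        rw [RKHS.coe_smul, fderiv_const_smul (hd a x)]; rfl }
  have hb : ∀ f, ‖ℓ f‖ ≤ (L * ‖v‖) * ‖f‖ := fun f => by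
    calc ‖ℓ f‖ ≤ ‖fderiv ℝ f x‖ * ‖v‖ := (fderiv ℝ f x).le_opNorm v
      _ ≤ (L * ‖f‖) * ‖v‖ := by gcongr; exact norm_fderiv_le_of_kerFun hL f x
      _ = _ := by ring
  refine ⟨(InnerProductSpace.toDual ℝ H).symm (ℓ.mkContinuous _ hb), fun f => ?_, ?_⟩
  · rw [InnerProductSpace.toDual_symm_apply]; rfl
  · rw [LinearIsometryEquiv.norm_map]
    exact ℓ.mkContinuous_norm_le (by positivity) hb

omit [NormedSpace ℝ E] in
/-- An RKHS over a separable space with continuous feature map is separable. -/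
lemma separableSpace_of_continuous_kerFun [TopologicalSpace.SeparableSpace E]
    (hc : Continuous fun x : E => RKHS.kerFun H x (1 : ℝ)) :
    TopologicalSpace.SeparableSpace H := by
  rw [← TopologicalSpace.isSeparable_univ_iff]
  have h1 : TopologicalSpace.IsSeparable (Set.range fun x : E => RKHS.kerFun H x (1 : ℝ)) :=
    TopologicalSpace.isSeparable_range hc
  have h2 := (h1.span (R := ℝ)).closure
  convert h2 using 1
  have h3 := RKHS.kerFun_dense H
  have h4 : Submodule.span ℝ {RKHS.kerFun H x v | (x : E) (v : ℝ)} ≤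
      Submodule.span ℝ (Set.range fun x : E => RKHS.kerFun H x (1 : ℝ)) := by
    rw [Submodule.span_le]
    rintro _ ⟨x, v, rfl⟩
    have : RKHS.kerFun H x v = v • RKHS.kerFun H x (1 : ℝ) := by
      rw [← map_smul]; simp
    rw [this]
    exact Submodule.smul_mem _ _ (Submodule.subset_span ⟨x, rfl⟩)
  symm
  rw [Set.eq_univ_iff_forall]
  intro f
  have h5 : f ∈ (Submodule.span ℝ {RKHS.kerFun H x v | (x : E) (v : ℝ)}).topologicalClosure := by
    rw [h3]; trivial
  exact closure_mono h4 h5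

end Differentiability

/-! ### Weak versus strong measurability in separable Hilbert spaces -/

section WeakMeasurability

variable {V : Type*} [NormedAddCommGroup V] [InnerProductSpace ℝ V]

/-- Distinct orthonormal vectors are √2 > 1 apart, so balls of radius 1/2 around them pick distinct
points of a countable dense set. -/
lemma countable_of_orthonormal [TopologicalSpace.SeparableSpace V] {ι : Type*} {v : ι → V}
    (hv : Orthonormal ℝ v) : Countable ι := by
  have hdist : ∀ i j, i ≠ j → 1 < dist (v i) (v j) := by
    intro i j hij
    have h1 : ‖v i - v j‖ ^ 2 = 2 := by
      rw [norm_sub_sq_real, hv.1 i, hv.1 j, hv.2 hij]; norm_num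
    rw [dist_eq_norm]
    nlinarith [norm_nonneg (v i - v j)]
  obtain ⟨s, hs, hsd⟩ := TopologicalSpace.exists_countable_dense V
  have := hs.to_subtype
  choose g hg using fun i => hsd.exists_dist_lt (v i) (show (0 : ℝ) < 1 / 2 by norm_num)
  refine Function.Injective.countable (f := fun i => (⟨g i, (hg i).1⟩ : s)) fun i j hij => ?_
  by_contra hne
  have h2 : g i = g j := congrArg Subtype.val hij
  have h3 := dist_triangle (v i) (g i) (v j)
  have h4 := (hg j).2
  have h5 := (hg i).2
  rw [← h2, dist_comm] at h4
  linarith [hdist i j hne]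

/-- A weakly measurable map into a separable Hilbert space is strongly measurable. -/
lemma stronglyMeasurable_of_inner [CompleteSpace V] [TopologicalSpace.SeparableSpace V]
    {Ω : Type*} [MeasurableSpace Ω] {ξ : Ω → V} (h : ∀ v, Measurable fun x => inner ℝ (ξ x) v) :
    StronglyMeasurable ξ := by
  obtain ⟨s, b, -⟩ := exists_hilbertBasis ℝ V
  have := countable_of_orthonormal b.orthonormal
  refine stronglyMeasurable_of_tendsto (u := (atTop : Filter (Finset s)))
    (f := fun t x => ∑ i ∈ t, b.repr (ξ x) i • b i) (fun t => ?_) ?_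
  · refine Finset.stronglyMeasurable_fun_sum _ fun i _ => ?_
    have : Measurable fun x => b.repr (ξ x) i := by
      simp_rw [b.repr_apply_apply, real_inner_comm]
      exact h _
    exact this.stronglyMeasurable.smul_const _
  · exact tendsto_pi_nhds.2 fun x => b.hasSum_repr (ξ x)

end WeakMeasurability

/-! ### Quadratic and Lipschitz estimates for h and w -/

/-- A bounded even `C^2` function is flat to second order at the origin. -/
lemma exists_abs_sub_le_sq {E : Type*} [NormedAddCommGroup E] [NormedSpace ℝ E] {h : E → ℝ}
    (hh : ContDiff ℝ 2 h) (heven : ∀ z, h (-z) = h z) {M : ℝ} (hM : ∀ z, |h z| ≤ M) :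
    ∃ C, 0 ≤ C ∧ ∀ z, |h 0 - h z| ≤ C * ‖z‖ ^ 2 := by
  have hM0 : 0 ≤ M := (abs_nonneg _).trans (hM 0)
  have hd : Differentiable ℝ h := hh.differentiable (by norm_num)
  have h0 : fderiv ℝ h 0 = 0 := by
    have h1 : HasFDerivAt (fun z => h (-z)) (-(fderiv ℝ h 0)) 0 := by
      have h2 : HasFDerivAt h (fderiv ℝ h 0) (-0 : E) := by
        rw [neg_zero]; exact (hd 0).hasFDerivAt
      have h3 := h2.comp (0 : E) (hasFDerivAt_id (𝕜 := ℝ) (0 : E)).neg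
      refine h3.congr_fderiv ?_
      ext v
      simp
    simp_rw [heven] at h1
    have h4 := h1.unique (hd 0).hasFDerivAt
    ext v
    have := congrArg (fun L => L v) h4
    simp at this ⊢
    linarith
  obtain ⟨K, s, hs, hK⟩ := ((hh.fderiv_right (m := 1) (by norm_num)).contDiffAt
    (x := (0 : E))).exists_lipschitzOnWith
  obtain ⟨r, hr, hrs⟩ := Metric.mem_nhds_iff.1 hs
  -- K serves near 0, where the derivative vanishes at 0 and is K-Lipschitz; 2M / r² serves for ‖z‖
  -- ≥ r, where boundedness is enough.
  refine ⟨K + 2 * M / r ^ 2, by positivity, fun z => ?_⟩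
  by_cases hz : ‖z‖ < r
  · have hb : ∀ y ∈ Metric.closedBall (0 : E) ‖z‖, ‖fderiv ℝ h y‖ ≤ K * ‖z‖ := by
      intro y hy
      rw [mem_closedBall_zero_iff] at hy
      have h5 := hK.dist_le_mul y (hrs (by simpa using hy.trans_lt hz)) 0
        (hrs (by simpa using hr))
      rw [h0, dist_zero_right, dist_zero_right] at h5
      exact h5.trans (by gcongr)
    have h6 := (convex_closedBall (0 : E) ‖z‖).norm_image_sub_le_of_norm_fderiv_le
      (fun y _ => hd y) hb (x := z) (y := 0) (by simp) (by simp)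
    rw [zero_sub, norm_neg, Real.norm_eq_abs] at h6
    have : 0 ≤ 2 * M / r ^ 2 * ‖z‖ ^ 2 := by positivity
    nlinarith
  · push Not at hz
    have h7 : |h 0 - h z| ≤ 2 * M := (abs_sub _ _).trans (by linarith [hM 0, hM z])
    have h8 : 2 * M ≤ 2 * M / r ^ 2 * ‖z‖ ^ 2 := by
      rw [div_mul_eq_mul_div, le_div_iff₀ (by positivity)]
      gcongr
    have : 0 ≤ K * ‖z‖ ^ 2 := by positivity
    linarith

variable {d : ℕ}

lemma gradient_apply_eq_fderiv (f : Euc d → ℝ) (x : Euc d) (j : Fin d) :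
    gradient f x j = fderiv ℝ f x (EuclideanSpace.single j 1) := by
  have h := EuclideanSpace.inner_single_right (𝕜 := ℝ) j 1 (gradient f x)
  rw [gradient, InnerProductSpace.toDual_symm_apply] at h
  simpa [gradient] using h.symm

lemma norm_fderiv_eq_norm_gradient (f : Euc d → ℝ) (x : Euc d) :
    ‖fderiv ℝ f x‖ = ‖gradient f x‖ := by
  rw [gradient, LinearIsometryEquiv.norm_map]

lemma IsCb1.exists_abs_sub_le {w : Euc d → ℝ} (hw : IsCb1 w) :
    ∃ C, 0 ≤ C ∧ ∀ x y, |w x - w y| ≤ C * ‖x - y‖ := by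
  obtain ⟨hc, -, C, hC⟩ := hw
  refine ⟨C, (norm_nonneg _).trans (hC 0), fun x y => ?_⟩
  exact convex_univ.norm_image_sub_le_of_norm_fderiv_le
    (fun z _ => hc.differentiable (by norm_num) z)
    (fun z _ => (norm_fderiv_eq_norm_gradient w z).trans_le (hC z)) (Set.mem_univ y)
    (Set.mem_univ x)

/-! ### The Stein feature map -/

section RKHS

variable {H : Type*} [NormedAddCommGroup H] [InnerProductSpace ℝ H] [CompleteSpace H]
  [RKHS ℝ H (Euc d) ℝ] {w h : Euc d → ℝ}

lemma kerFun_one_apply {k : Euc d → Euc d → ℝ}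
    (hH : ∀ x x', RKHS.kernel H x x' (1 : ℝ) = k x x') (x y : Euc d) :
    RKHS.kerFun H y (1 : ℝ) x = k x y := by
  rw [RKHS.kerFun_apply, hH]

/-- The feature map of a tilted kernel is globally Lipschitz. -/
lemma exists_lipschitz_kerFun (hh : IsCb2 h)
    (hhk : IsReproducingKernel (fun x x' => h (x - x'))) (hw : IsCb1 w)
    (hH : ∀ x x', RKHS.kernel H x x' (1 : ℝ) = tiltedKernel w h x x') :
    ∃ L : NNReal, ∀ x y : Euc d,
      ‖RKHS.kerFun H x (1 : ℝ) - RKHS.kerFun H y (1 : ℝ)‖ ≤ L * ‖x - y‖ := by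
  obtain ⟨M, hM⟩ := hh.2.1.2.1
  obtain ⟨W, hW⟩ := hw.2.1
  have hW0 : 0 ≤ W := (abs_nonneg _).trans (hW 0)
  have heven : ∀ z, h (-z) = h z := fun z => by simpa using hhk.1 0 z
  obtain ⟨C, hC0, hC⟩ := exists_abs_sub_le_sq hh.1 heven hM
  obtain ⟨D, hD0, hD⟩ := hw.exists_abs_sub_le
  -- The squared distance of the features is (w x - w y)² h(0) + 2 w(x) w(y) (h(0) - h(x - y)); both
  -- terms are O(‖x - y‖²).
  refine ⟨Real.toNNReal √(D ^ 2 * |h 0| + 2 * W ^ 2 * C), fun x y => ?_⟩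
  rw [Real.coe_toNNReal _ (Real.sqrt_nonneg _)]
  refine abs_le_of_sq_le_sq' ?_ (by positivity) |>.2
  rw [mul_pow, Real.sq_sqrt (by positivity), norm_sub_sq_real, ← real_inner_self_eq_norm_sq,
    ← real_inner_self_eq_norm_sq]
  simp only [inner_kerFun_one, kerFun_one_apply hH, tiltedKernel, sub_self]
  have h1 : (w x - w y) ^ 2 * h 0 ≤ (D * ‖x - y‖) ^ 2 * |h 0| := by
    refine mul_le_mul_of_nonneg (sq_le_sq.2 ?_) (le_abs_self _) (sq_nonneg _) (abs_nonneg _)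
    exact (hD x y).trans (le_abs_self _)
  have h2 : w x * w y * (h 0 - h (x - y)) ≤ W * W * (C * ‖x - y‖ ^ 2) := by
    refine (le_abs_self _).trans ?_
    rw [abs_mul, abs_mul]
    gcongr
    exacts [hW x, hW y, hC _]
  nlinarith

/-- The feature map of the Stein kernel: a bounded strongly measurable map into `H^d` that represents
the Langevin Stein operator and has the Stein kernel as its Gram kernel. -/
theorem exists_stein_feature (p : Euc d → ℝ) (hh : IsCb2 h)
    (hhk : IsReproducingKernel (fun x x' => h (x - x'))) (hw : IsCb1 w)
    (hws : ∃ C, ∀ x, ‖w x • score p x‖ ≤ C)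
    (hH : ∀ x x', RKHS.kernel H x x' (1 : ℝ) = tiltedKernel w h x x') :
    ∃ ξ : Euc d → PiLp 2 (fun _ : Fin d => H), StronglyMeasurable ξ ∧
      (∃ C, ∀ x, ‖ξ x‖ ≤ C) ∧
      (∀ (f : PiLp 2 (fun _ : Fin d => H)) x,
        inner ℝ (ξ x) f = langevinStein p (fun j => ⇑(f j)) x) ∧
      ∀ x x', inner ℝ (ξ x) (ξ x') = steinKernel p (tiltedKernel w h) x x' := by
  obtain ⟨L, hL⟩ := exists_lipschitz_kerFun hh hhk hw hH
  have hwd : Differentiable ℝ w := hw.1.differentiable (by norm_num)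
  have hhd : Differentiable ℝ h := hh.1.differentiable (by norm_num)
  have hd : ∀ f : H, Differentiable ℝ f := by
    refine differentiable_of_kerFun hL fun y => ?_
    have : ⇑(RKHS.kerFun H y (1 : ℝ)) = fun x => w x * h (x - y) * w y :=
      funext fun x => kerFun_one_apply hH x y
    rw [this]
    fun_prop
  have hgrad : ∀ x (j : Fin d), ∃ ψ : H, (∀ f : H, inner ℝ ψ f = gradient f x j) ∧ ‖ψ‖ ≤ L := by
    intro x j
    obtain ⟨ψ, h1, h2⟩ := exists_fderiv_representer hL hd x (EuclideanSpace.single j 1)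
    refine ⟨ψ, fun f => (h1 f).trans (gradient_apply_eq_fderiv _ _ _).symm, ?_⟩
    simpa using h2
  choose ψ hψ hψL using hgrad
  let ξ : Euc d → PiLp 2 (fun _ : Fin d => H) := fun x =>
    WithLp.toLp 2 fun j => score p x j • RKHS.kerFun H x (1 : ℝ) + ψ x j
  have hξf : ∀ (f : PiLp 2 (fun _ : Fin d => H)) x,
      inner ℝ (ξ x) f = langevinStein p (fun j => ⇑(f j)) x := fun f x => by
    simp only [ξ, PiLp.inner_apply, inner_add_left, real_inner_smul_left, inner_kerFun_one, hψ,
      Finset.sum_add_distrib, langevinStein]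
  have hgm : ∀ (f : Euc d → ℝ) (j : Fin d), Measurable fun x => gradient f x j := fun f j => by
    simp_rw [gradient_apply_eq_fderiv]
    exact measurable_fderiv_apply_const ℝ f _
  have : TopologicalSpace.SeparableSpace H := by
    refine separableSpace_of_continuous_kerFun
      (LipschitzWith.of_dist_le_mul (K := L) fun x y => ?_).continuous
    simpa [dist_eq_norm] using hL x y
  have : SecondCountableTopology H := UniformSpace.secondCountable_of_separable H
  refine ⟨ξ, stronglyMeasurable_of_inner fun f => ?_, ?_, hξf, fun x x' => ?_⟩
  · simp_rw [hξf, langevinStein]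
    refine (Finset.measurable_fun_sum _ fun j _ => (hgm _ j).mul (hd (f j)).continuous.measurable).add
      (Finset.measurable_fun_sum _ fun j _ => hgm _ j)
  · obtain ⟨C, hC⟩ := hws
    have hb : ∀ x j, ‖score p x j • RKHS.kerFun H x (1 : ℝ) + ψ x j‖ ≤ C * √|h 0| + L := by
      intro x j
      refine (norm_add_le _ _).trans (add_le_add ?_ (hψL x j))
      have h1 : ‖RKHS.kerFun H x (1 : ℝ)‖ ≤ |w x| * √|h 0| := by
        refine abs_le_of_sq_le_sq' ?_ (by positivity) |>.2
        rw [← real_inner_self_eq_norm_sq, inner_kerFun_one, kerFun_one_apply hH, tiltedKernel,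
          sub_self, mul_pow, sq_abs, Real.sq_sqrt (abs_nonneg _)]
        nlinarith [le_abs_self (h 0), sq_nonneg (w x)]
      -- The score alone may be unbounded; the factor |w x| comes from the norm of the kernel
      -- section.
      have h2 : |w x| * |score p x j| ≤ C := by
        have := (PiLp.norm_apply_le (w x • score p x) j).trans (hC x)
        simpa [abs_mul] using this
      rw [norm_smul, Real.norm_eq_abs]
      calc |score p x j| * ‖RKHS.kerFun H x (1 : ℝ)‖ ≤ |score p x j| * (|w x| * √|h 0|) := by
            gcongr
        _ = (|w x| * |score p x j|) * √|h 0| := by ring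
        _ ≤ C * √|h 0| := by gcongr
    refine ⟨√(d * (C * √|h 0| + L) ^ 2), fun x => ?_⟩
    rw [PiLp.norm_eq_of_L2]
    refine Real.sqrt_le_sqrt ?_
    calc _ ≤ ∑ j : Fin d, (C * √|h 0| + L) ^ 2 := by
          gcongr with j
          exact hb x j
      _ = _ := by simp
  · rw [hξf, langevinStein]
    have hφ : ∀ y, ⇑(RKHS.kerFun H y (1 : ℝ)) = fun x => tiltedKernel w h x y := fun y =>
      funext fun x => kerFun_one_apply hH x y
    have hsymm : ∀ x y, tiltedKernel w h x y = tiltedKernel w h y x := fun x y => by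
      have := hhk.1 x y
      simp only [tiltedKernel] at this ⊢
      rw [this]; ring
    have hψf : ∀ y j, ⇑(ψ y j) = fun x => gradient (fun y' => tiltedKernel w h x y') y j := by
      intro y j
      funext x
      rw [← inner_kerFun_one x, real_inner_comm, hψ, hφ]
      simp_rw [hsymm _ x]
    have hcoe : ∀ j, ⇑(ξ x' j) = fun y => score p x' j * tiltedKernel w h y x' +
        gradient (fun y' => tiltedKernel w h y y') x' j := by
      intro j
      simp only [ξ, RKHS.coe_add, RKHS.coe_smul, hφ, hψf]
      rfl
    -- The mixed derivative of k appears by pairing two derivative representers, so k need not be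
    -- differentiated explicitly.
    have hgr : ∀ j, gradient (ξ x' j) x j = score p x' j *
        gradient (fun y => tiltedKernel w h y x') x j +
        gradient (fun y => gradient (fun y' => tiltedKernel w h y y') x' j) x j := by
      intro j
      rw [← hψ, ← hψf, ← hφ, ← hψ, ← hψ]
      simp only [ξ, inner_add_right, real_inner_smul_right]
    simp only [hgr]
    simp only [hcoe, steinKernel, PiLp.inner_apply, Finset.sum_add_distrib, mul_add]
    simp only [RCLike.inner_apply, conj_trivial, Finset.sum_mul]
    rw [← sub_eq_zero]
    simp only [mul_comm, mul_left_comm]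
    ring

end RKHS

/-! ### McDiarmid's inequality and variance of sums for independent copies -/

section Product

variable {E : Type*} [MeasurableSpace E]

lemma measurable_cons (n : ℕ) :
    Measurable fun z : E × (Fin n → E) => (Fin.cons z.1 z.2 : Fin (n + 1) → E) := by
  refine measurable_pi_iff.2 fun i => ?_
  refine Fin.cases ?_ (fun j => ?_) i
  · simpa using measurable_fst
  · simp only [Fin.cons_succ]
    fun_prop

variable (μ : Measure E) [IsProbabilityMeasure μ]

lemma map_cons_prod_pi (n : ℕ) :
    (μ.prod (Measure.pi fun _ : Fin n => μ)).map
      (fun z => (Fin.cons z.1 z.2 : Fin (n + 1) → E)) = Measure.pi fun _ : Fin (n + 1) => μ := by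
  have h := (measurePreserving_piFinSuccAbove (fun _ : Fin (n + 1) => μ) 0).symm.map_eq
  rw [← h]
  congr 1
  funext z
  simp [MeasurableEquiv.piFinSuccAbove_symm_apply, Fin.insertNthEquiv]

/-- Fubini's theorem for bounded measurable functions of independent copies. -/
lemma integral_pi_succ {n : ℕ} {g : (Fin (n + 1) → E) → ℝ} (hg : Measurable g) {C : ℝ}
    (hC : ∀ X, |g X| ≤ C) :
    ∫ X, g X ∂(Measure.pi fun _ : Fin (n + 1) => μ) =
      ∫ Y, ∫ x, g (Fin.cons x Y) ∂μ ∂(Measure.pi fun _ : Fin n => μ) := by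
  rw [← map_cons_prod_pi, integral_map (measurable_cons n).aemeasurable hg.aestronglyMeasurable]
  refine integral_prod_symm (fun z : E × (Fin n → E) => g (Fin.cons z.1 z.2)) ?_
  exact Integrable.of_bound (hg.comp (measurable_cons n)).aestronglyMeasurable C
    (Eventually.of_forall fun z => hC _)

/-- Hoeffding's lemma for a bounded function with oscillation at most `c`. -/
lemma integral_exp_le_of_oscillation {f : E → ℝ} (hf : Measurable f) {C c : ℝ}
    (hC : ∀ x, |f x| ≤ C) (hc : ∀ x y, |f x - f y| ≤ c) (t : ℝ) :
    ∫ x, Real.exp (t * (f x - ∫ y, f y ∂μ)) ∂μ ≤ Real.exp (c ^ 2 * t ^ 2 / 8) := by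
  have : Nonempty E := nonempty_of_isProbabilityMeasure μ
  have hbdd : BddBelow (Set.range f) := ⟨-C, by rintro _ ⟨x, rfl⟩; exact (abs_le.1 (hC x)).1⟩
  have hmem : ∀ x, f x ∈ Set.Icc (⨅ y, f y) ((⨅ y, f y) + c) := fun x => by
    refine ⟨ciInf_le hbdd x, ?_⟩
    rw [← sub_le_iff_le_add]
    exact le_ciInf fun y => by linarith [(abs_le.1 (hc x y)).2]
  have h := (hasSubgaussianMGF_of_mem_Icc (μ := μ) hf.aemeasurable
    (Eventually.of_forall hmem)).mgf_le t
  rw [mgf] at h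
  refine h.trans_eq ?_
  congr 1
  push_cast
  rw [add_sub_cancel_left, Real.norm_eq_abs, div_pow, sq_abs]
  ring

/-- McDiarmid's inequality in its moment generating function form. -/
theorem integral_exp_le_of_bounded_differences {c C : ℝ} (t : ℝ) (n : ℕ) :
    ∀ F : (Fin n → E) → ℝ, Measurable F → (∀ X, |F X| ≤ C) →
      (∀ i X x, |F (Function.update X i x) - F X| ≤ c) →
      ∫ X, Real.exp (t * (F X - ∫ Y, F Y ∂(Measure.pi fun _ : Fin n => μ)))
        ∂(Measure.pi fun _ : Fin n => μ) ≤ Real.exp (n * c ^ 2 * t ^ 2 / 8) := by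
  induction n with
  | zero =>
    intro F _ _ _
    have h : F = fun _ => F default := funext fun X => congrArg F (Subsingleton.elim _ _)
    rw [h]
    simp
  | succ n ih =>
    intro F hF hC hc
    have hFc : Measurable fun z : E × (Fin n → E) => F (Fin.cons z.1 z.2) :=
      hF.comp (measurable_cons n)
    have hFx : ∀ Y : Fin n → E, Measurable fun x => F (Fin.cons x Y) := fun Y =>
      hFc.comp measurable_prodMk_right
    have hFi : ∀ Y : Fin n → E, Integrable (fun x => F (Fin.cons x Y)) μ := fun Y =>
      Integrable.of_bound (hFx Y).aestronglyMeasurable C (Eventually.of_forall fun x => hC _)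
    -- Averaging out the first coordinate preserves the bound and the bounded differences.
    -- Hoeffding's lemma handles F - G in that coordinate, and the induction hypothesis handles G.
    set G : (Fin n → E) → ℝ := fun Y => ∫ x, F (Fin.cons x Y) ∂μ with hG
    have hGm : Measurable G :=
      (hFc.stronglyMeasurable.integral_prod_left' (μ := μ)).measurable
    have hGC : ∀ Y, |G Y| ≤ C := fun Y => by
      have := norm_integral_le_of_norm_le_const (μ := μ) (f := fun x => F (Fin.cons x Y))
        (Eventually.of_forall fun x => hC _)
      simpa using this
    have hGc : ∀ i Y y, |G (Function.update Y i y) - G Y| ≤ c := fun i Y y => by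
      rw [hG]
      simp only
      rw [← integral_sub (hFi _) (hFi _)]
      have := norm_integral_le_of_norm_le_const (μ := μ) (C := c)
        (f := fun x => F (Fin.cons x (Function.update Y i y)) - F (Fin.cons x Y))
        (Eventually.of_forall fun x => by
          rw [Fin.cons_update, Real.norm_eq_abs]
          exact hc _ _ _)
      simpa using this
    rw [integral_pi_succ μ hF hC]
    set m := ∫ Y, G Y ∂(Measure.pi fun _ : Fin n => μ)
    have hexpC : ∀ s, |s| ≤ C → |Real.exp (t * (s - m))| ≤ Real.exp (|t| * (C + |m|)) := by
      intro s hs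
      rw [Real.abs_exp, Real.exp_le_exp]
      calc t * (s - m) ≤ |t * (s - m)| := le_abs_self _
        _ = |t| * |s - m| := abs_mul _ _
        _ ≤ |t| * (C + |m|) := by
          gcongr
          exact (abs_sub _ _).trans (by gcongr)
    rw [integral_pi_succ μ (g := fun X => Real.exp (t * (F X - m)))
      (((hF.sub_const m).const_mul t).exp) (fun X => hexpC _ (hC X))]
    have hin : ∀ Y, ∫ x, Real.exp (t * (F (Fin.cons x Y) - m)) ∂μ ≤
        Real.exp (c ^ 2 * t ^ 2 / 8) * Real.exp (t * (G Y - m)) := fun Y => by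
      have h1 : ∀ x, Real.exp (t * (F (Fin.cons x Y) - m)) =
          Real.exp (t * (F (Fin.cons x Y) - G Y)) * Real.exp (t * (G Y - m)) := fun x => by
        rw [← Real.exp_add]; congr 1; ring
      simp_rw [h1]
      rw [integral_mul_const]
      gcongr
      refine integral_exp_le_of_oscillation μ (hFx Y) (fun x => hC _) (fun x y => ?_) t
      have := hc 0 (Fin.cons y Y) x
      rwa [Fin.update_cons_zero] at this
    have hint : Integrable (fun Y => Real.exp (t * (G Y - m)))
        (Measure.pi fun _ : Fin n => μ) :=
      Integrable.of_bound ((hGm.sub_const m).const_mul t).exp.aestronglyMeasurable _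
        (Eventually.of_forall fun Y => hexpC _ (hGC Y))
    calc _ ≤ ∫ Y, Real.exp (c ^ 2 * t ^ 2 / 8) * Real.exp (t * (G Y - m))
            ∂(Measure.pi fun _ : Fin n => μ) :=
          integral_mono_of_nonneg (Eventually.of_forall fun Y => by positivity)
            (hint.const_mul _) (Eventually.of_forall hin)
      _ = Real.exp (c ^ 2 * t ^ 2 / 8) * ∫ Y, Real.exp (t * (G Y - m))
            ∂(Measure.pi fun _ : Fin n => μ) := integral_const_mul _ _
      _ ≤ Real.exp (c ^ 2 * t ^ 2 / 8) * Real.exp (n * c ^ 2 * t ^ 2 / 8) := by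
          gcongr
          exact ih G hGm hGC hGc
      _ = _ := by
          rw [← Real.exp_add]; congr 1; push_cast; ring

/-- McDiarmid's inequality. -/
theorem measure_ge_le_of_bounded_differences {n : ℕ} {F : (Fin n → E) → ℝ} (hF : Measurable F)
    {c C : ℝ} (hC : ∀ X, |F X| ≤ C) (hc : ∀ i X x, |F (Function.update X i x) - F X| ≤ c)
    {ε : ℝ} (hε : 0 ≤ ε) :
    (Measure.pi fun _ : Fin n => μ).real
        {X | ε ≤ F X - ∫ Y, F Y ∂(Measure.pi fun _ : Fin n => μ)} ≤
      Real.exp (-ε ^ 2 / (n * c ^ 2 / 2)) := by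
  set m := ∫ Y, F Y ∂(Measure.pi fun _ : Fin n => μ) with hm
  have h : HasSubgaussianMGF (fun X => F X - m) (Real.toNNReal (n * c ^ 2 / 4))
      (Measure.pi fun _ : Fin n => μ) := by
    refine ⟨fun t => ?_, fun t => ?_⟩
    · refine Integrable.of_bound ((hF.sub_const m).const_mul t).exp.aestronglyMeasurable
        (Real.exp (|t| * (C + |m|))) (Eventually.of_forall fun X => ?_)
      rw [Real.norm_eq_abs, Real.abs_exp, Real.exp_le_exp]
      calc t * (F X - m) ≤ |t * (F X - m)| := le_abs_self _
        _ = |t| * |F X - m| := abs_mul _ _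
        _ ≤ |t| * (C + |m|) := by
          gcongr
          exact (abs_sub _ _).trans (by gcongr; exact hC X)
    · rw [Real.coe_toNNReal _ (by positivity)]
      refine (integral_exp_le_of_bounded_differences μ t n F hF hC hc).trans_eq ?_
      congr 1; ring
  refine (h.measure_ge_le hε).trans_eq ?_
  rw [Real.coe_toNNReal _ (by positivity)]
  congr 2; ring

variable {V : Type*} [NormedAddCommGroup V] [InnerProductSpace ℝ V] [CompleteSpace V]

/-- The variance of a sum of independent copies of a centred bounded random vector. -/
lemma integral_norm_sum_sq {η : E → V} (hη : StronglyMeasurable η) {C : ℝ}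
    (hC : ∀ x, ‖η x‖ ≤ C) (h0 : ∫ x, η x ∂μ = 0) (n : ℕ) :
    ∫ X, ‖∑ i, η (X i)‖ ^ 2 ∂(Measure.pi fun _ : Fin n => μ) = n * ∫ x, ‖η x‖ ^ 2 ∂μ := by
  have hηi : Integrable η μ := Integrable.of_bound hη.aestronglyMeasurable C
    (Eventually.of_forall hC)
  have hsm : ∀ n : ℕ, StronglyMeasurable fun X : Fin n → E => ∑ i, η (X i) := fun n =>
    Finset.stronglyMeasurable_fun_sum _ fun i _ => hη.comp_measurable (measurable_pi_apply i)
  have hsb : ∀ (n : ℕ) (X : Fin n → E), |‖∑ i, η (X i)‖ ^ 2| ≤ (n * C) ^ 2 := fun n X => by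
    rw [abs_of_nonneg (by positivity)]
    gcongr
    refine (norm_sum_le _ _).trans ((Finset.sum_le_sum fun i _ => hC (X i)).trans_eq ?_)
    simp
  have hsq : Integrable (fun x => ‖η x‖ ^ 2) μ :=
    Integrable.of_bound (hη.norm.pow 2).aestronglyMeasurable (C ^ 2)
      (Eventually.of_forall fun x => by
        rw [Real.norm_eq_abs, abs_of_nonneg (by positivity)]
        gcongr
        exact hC x)
  induction n with
  | zero => simp
  | succ n ih =>
    rw [integral_pi_succ μ ((hsm (n + 1)).norm.measurable.pow_const 2) (hsb (n + 1))]
    have hin : ∀ Y : Fin n → E, ∫ x, ‖∑ i, η ((Fin.cons x Y : Fin (n + 1) → E) i)‖ ^ 2 ∂μ =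
        ∫ x, ‖η x‖ ^ 2 ∂μ + ‖∑ i, η (Y i)‖ ^ 2 := fun Y => by
      -- The cross term integrates to zero because η is centred.
      simp_rw [Fin.sum_univ_succ, Fin.cons_zero, Fin.cons_succ, norm_add_sq_real]
      have hi : Integrable (fun x => 2 * inner ℝ (η x) (∑ i, η (Y i))) μ :=
        (hηi.inner_const _).const_mul 2
      have hs : Integrable (fun x => ‖η x‖ ^ 2 + 2 * inner ℝ (η x) (∑ i, η (Y i))) μ := hsq.add hi
      rw [integral_add hs (integrable_const _), integral_add hsq hi, integral_const_mul]
      simp_rw [real_inner_comm (∑ i, η (Y i))]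
      rw [integral_inner hηi, h0]
      simp
    have hsi : Integrable (fun Y : Fin n → E => ‖∑ i, η (Y i)‖ ^ 2)
        (Measure.pi fun _ : Fin n => μ) :=
      Integrable.of_bound ((hsm n).norm.pow 2).aestronglyMeasurable _
        (Eventually.of_forall (hsb n))
    simp_rw [hin]
    rw [integral_add (integrable_const _) hsi, ih]
    simp
    ring

end Product

/-! ### Concentration of the empirical mean of a bounded Hilbert-valued vector -/

section Concentration

variable {E : Type*} [MeasurableSpace E] (μ : Measure E) [IsProbabilityMeasure μ]
variable {V : Type*} [NormedAddCommGroup V] [InnerProductSpace ℝ V]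

/-- The distance of the empirical mean of `ξ` from its expectation. -/
noncomputable def meanDeviation (ξ : E → V) {n : ℕ} (X : Fin n → E) : ℝ :=
  ‖(n : ℝ)⁻¹ • ∑ i, ξ (X i) - ∫ x, ξ x ∂μ‖

variable {μ} {ξ : E → V} {τ : ℝ}

omit [IsProbabilityMeasure μ] in
lemma measurable_meanDeviation (hξ : StronglyMeasurable ξ) {n : ℕ} :
    Measurable (meanDeviation μ ξ (n := n)) :=
  (((Finset.stronglyMeasurable_fun_sum _ fun i _ =>
    hξ.comp_measurable (measurable_pi_apply i)).const_smul _).sub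
      stronglyMeasurable_const).norm.measurable

lemma norm_integral_le_sqrt (hτ : ∀ x, ‖ξ x‖ ≤ √τ) : ‖∫ x, ξ x ∂μ‖ ≤ √τ := by
  simpa using norm_integral_le_of_norm_le_const (μ := μ) (Eventually.of_forall hτ)

omit [IsProbabilityMeasure μ] in
lemma meanDeviation_nonneg {n : ℕ} (X : Fin n → E) : 0 ≤ meanDeviation μ ξ X := norm_nonneg _

lemma meanDeviation_le (hτ : ∀ x, ‖ξ x‖ ≤ √τ) {n : ℕ} (X : Fin n → E) :
    meanDeviation μ ξ X ≤ 2 * √τ := by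
  have h1 : ‖(n : ℝ)⁻¹ • ∑ i, ξ (X i)‖ ≤ √τ := by
    rw [norm_smul, norm_inv, Real.norm_natCast]
    calc (n : ℝ)⁻¹ * ‖∑ i, ξ (X i)‖ ≤ (n : ℝ)⁻¹ * (n * √τ) := by
          gcongr
          refine (norm_sum_le _ _).trans ((Finset.sum_le_sum fun i _ => hτ (X i)).trans_eq ?_)
          simp
      _ = ((n : ℝ)⁻¹ * n) * √τ := by ring
      _ ≤ 1 * √τ := by gcongr; exact inv_mul_le_one
      _ = √τ := one_mul _
  exact (norm_sub_le _ _).trans (by linarith [norm_integral_le_sqrt (μ := μ) hτ])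

omit [IsProbabilityMeasure μ] in
lemma abs_meanDeviation_update_sub_le (hτ : ∀ x, ‖ξ x‖ ≤ √τ) {n : ℕ} (i : Fin n) (X : Fin n → E)
    (x : E) :
    |meanDeviation μ ξ (Function.update X i x) - meanDeviation μ ξ X| ≤ 2 * √τ / n := by
  refine (abs_norm_sub_norm_le _ _).trans ?_
  rw [sub_sub_sub_cancel_right, ← smul_sub, ← Finset.sum_sub_distrib,
    Finset.sum_eq_single i (fun j _ hj => by simp [hj]) (by simp), Function.update_self,
    norm_smul, norm_inv, Real.norm_natCast, div_eq_inv_mul]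
  gcongr
  exact (norm_sub_le _ _).trans (by linarith [hτ x, hτ (X i)])

variable [CompleteSpace V]

lemma integral_meanDeviation_sq_le (hξ : StronglyMeasurable ξ) (hτ0 : 0 ≤ τ)
    (hτ : ∀ x, ‖ξ x‖ ≤ √τ) {n : ℕ} (hn : 0 < n) :
    ∫ X, meanDeviation μ ξ X ^ 2 ∂(Measure.pi fun _ : Fin n => μ) ≤ τ / n := by
  set m := ∫ x, ξ x ∂μ with hm
  have hn' : (n : ℝ) ≠ 0 := by positivity
  have hξi : Integrable ξ μ := Integrable.of_bound hξ.aestronglyMeasurable _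
    (Eventually.of_forall hτ)
  have hF : ∀ X : Fin n → E,
      meanDeviation μ ξ X ^ 2 = ((n : ℝ) ^ 2)⁻¹ * ‖∑ i, (ξ (X i) - m)‖ ^ 2 := fun X => by
    have : (n : ℝ)⁻¹ • ∑ i, ξ (X i) - m = (n : ℝ)⁻¹ • ∑ i, (ξ (X i) - m) := by
      rw [Finset.sum_sub_distrib, smul_sub]
      simp [← Nat.cast_smul_eq_nsmul ℝ, smul_smul, hn']
    rw [meanDeviation, ← hm, this, norm_smul, mul_pow, norm_inv, Real.norm_natCast, inv_pow]
  have hvar : ∫ x, ‖ξ x - m‖ ^ 2 ∂μ ≤ τ := by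
    have hsq : Integrable (fun x => ‖ξ x‖ ^ 2) μ :=
      Integrable.of_bound (hξ.norm.pow 2).aestronglyMeasurable (√τ ^ 2)
        (Eventually.of_forall fun x => by
          rw [Real.norm_eq_abs, abs_of_nonneg (by positivity)]
          gcongr
          exact hτ x)
    have hi : Integrable (fun x => 2 * inner ℝ (ξ x) m) μ := (hξi.inner_const _).const_mul 2
    have hs : Integrable (fun x => ‖ξ x‖ ^ 2 - 2 * inner ℝ (ξ x) m) μ := hsq.sub hi
    simp_rw [norm_sub_sq_real]
    rw [integral_add hs (integrable_const _), integral_sub hsq hi, integral_const_mul]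
    simp_rw [real_inner_comm m]
    rw [integral_inner hξi, ← hm, real_inner_self_eq_norm_sq]
    have h2 : ∫ x, ‖ξ x‖ ^ 2 ∂μ ≤ ∫ _, τ ∂μ := integral_mono hsq (integrable_const _) fun x => by
      have := hτ x
      calc ‖ξ x‖ ^ 2 ≤ √τ ^ 2 := by gcongr
        _ = τ := Real.sq_sqrt hτ0
    simp at h2 ⊢
    nlinarith [sq_nonneg ‖m‖]
  simp_rw [hF]
  rw [integral_const_mul, integral_norm_sum_sq μ (η := fun x => ξ x - m)
    (hξ.sub stronglyMeasurable_const)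
    (C := √τ + ‖m‖) (fun x => (norm_sub_le _ _).trans (by gcongr; exact hτ x))
    (by rw [integral_sub hξi (integrable_const _)]; simp [hm])]
  calc ((n : ℝ) ^ 2)⁻¹ * (n * ∫ x, ‖ξ x - m‖ ^ 2 ∂μ) ≤ ((n : ℝ) ^ 2)⁻¹ * (n * τ) := by gcongr
    _ = τ / n := by field_simp

/-- Nonnegativity of the variance bounds the squared mean by the second moment. -/
lemma integral_meanDeviation_le (hξ : StronglyMeasurable ξ) (hτ0 : 0 ≤ τ)
    (hτ : ∀ x, ‖ξ x‖ ≤ √τ) {n : ℕ} (hn : 0 < n) :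
    ∫ X, meanDeviation μ ξ X ∂(Measure.pi fun _ : Fin n => μ) ≤ √(τ / n) := by
  refine Real.le_sqrt_of_sq_le (le_trans ?_ (integral_meanDeviation_sq_le (μ := μ) hξ hτ0 hτ hn))
  have hmem : MemLp (meanDeviation μ ξ (n := n)) 2 (Measure.pi fun _ : Fin n => μ) :=
    MemLp.of_bound (measurable_meanDeviation hξ).aestronglyMeasurable (2 * √τ)
      (Eventually.of_forall fun X => by
        rw [Real.norm_eq_abs, abs_of_nonneg (meanDeviation_nonneg X)]
        exact meanDeviation_le hτ X)
  have h := variance_nonneg (meanDeviation μ ξ (n := n)) (Measure.pi fun _ : Fin n => μ)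
  rw [variance_eq_sub hmem] at h
  simpa using h

/-- Concentration of the empirical mean of a bounded random vector. -/
theorem measure_lt_meanDeviation_le (hξ : StronglyMeasurable ξ) (hτ0 : 0 ≤ τ)
    (hτ : ∀ x, ‖ξ x‖ ≤ √τ) {α : ℝ} (hα0 : 0 < α) (hα1 : α < 1) {n : ℕ} (hn : 0 < n) :
    (Measure.pi fun _ : Fin n => μ)
      {X | √(τ / n) + √(-2 * τ * Real.log α / n) < meanDeviation μ ξ X} ≤ ENNReal.ofReal α := by
  have hn' : (0 : ℝ) < n := by positivity
  -- If τ = 0 the deviation is identically 0; this case is separate because the McDiarmid exponent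
  -- divides by τ.
  rcases hτ0.eq_or_lt with rfl | hpos
  · have : {X : Fin n → E |
        √(0 / (n : ℝ)) + √(-2 * 0 * Real.log α / n) < meanDeviation μ ξ X} = ∅ := by
      refine Set.eq_empty_of_forall_notMem fun X hX => ?_
      have h1 := meanDeviation_le (μ := μ) hτ X
      simp at hX h1
      linarith
    rw [this]
    simp
  have hlog : 0 ≤ -2 * τ * Real.log α / n := by
    have := Real.log_neg hα0 hα1
    apply div_nonneg _ hn'.le
    nlinarith
  have h := measure_ge_le_of_bounded_differences μ (measurable_meanDeviation (μ := μ) hξ)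
    (C := 2 * √τ) (fun X => by
        rw [abs_of_nonneg (meanDeviation_nonneg X)]
        exact meanDeviation_le hτ X)
    (fun i X x => abs_meanDeviation_update_sub_le (n := n) hτ i X x)
    (Real.sqrt_nonneg (-2 * τ * Real.log α / n))
  -- With differences c = 2√τ / n, the denominator n c² / 2 is 2τ / n, so the second term of the
  -- threshold is exactly what makes the tail bound α.
  have he : -√(-2 * τ * Real.log α / n) ^ 2 / (n * (2 * √τ / n) ^ 2 / 2) = Real.log α := by
    rw [Real.sq_sqrt hlog, div_pow, mul_pow, Real.sq_sqrt hτ0]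
    field_simp
  rw [he, Real.exp_log hα0] at h
  refine le_trans (measure_mono fun X hX => ?_)
    ((ENNReal.le_ofReal_iff_toReal_le (measure_ne_top _ _) hα0.le).2 h)
  have := integral_meanDeviation_le (μ := μ) hξ hτ0 hτ hn
  simp only [Set.mem_ofPred_eq] at hX ⊢
  linarith

/-- Chebyshev's inequality for the empirical mean of a bounded random vector. -/
lemma measure_le_meanDeviation_le (hξ : StronglyMeasurable ξ) (hτ0 : 0 ≤ τ)
    (hτ : ∀ x, ‖ξ x‖ ≤ √τ) {δ : ℝ} (hδ : 0 < δ) {n : ℕ} (hn : 0 < n) :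
    (Measure.pi fun _ : Fin n => μ) {X | δ ≤ meanDeviation μ ξ X} ≤
      ENNReal.ofReal (τ / δ ^ 2 * (n : ℝ)⁻¹) := by
  refine (ENNReal.le_ofReal_iff_toReal_le (measure_ne_top _ _) (by positivity)).2 ?_
  have hint : Integrable (fun X => meanDeviation μ ξ X ^ 2) (Measure.pi fun _ : Fin n => μ) :=
    Integrable.of_bound ((measurable_meanDeviation hξ).pow_const 2).aestronglyMeasurable
      ((2 * √τ) ^ 2) (Eventually.of_forall fun X => by
        rw [Real.norm_eq_abs, abs_of_nonneg (by positivity)]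
        gcongr
        · exact meanDeviation_nonneg X
        · exact meanDeviation_le hτ X)
  have h := mul_meas_ge_le_integral_of_nonneg
    (Eventually.of_forall fun X => sq_nonneg (meanDeviation μ ξ X)) hint (δ ^ 2)
  have hset : {X : Fin n → E | δ ^ 2 ≤ meanDeviation μ ξ X ^ 2} =
      {X | δ ≤ meanDeviation μ ξ X} := by
    ext X
    exact pow_le_pow_iff_left₀ hδ.le (meanDeviation_nonneg X) two_ne_zero
  rw [hset] at h
  have h2 := h.trans (integral_meanDeviation_sq_le hξ hτ0 hτ hn)
  rw [← measureReal_def, div_mul_eq_mul_div, le_div_iff₀ (by positivity), mul_comm,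
    ← div_eq_mul_inv]
  exact h2

end Concentration

/-! ### The discrepancy and its V-statistic as norms of means -/

section Discrepancy

variable {d : ℕ} {H : Type*} [NormedAddCommGroup H] [InnerProductSpace ℝ H] [CompleteSpace H]
  [RKHS ℝ H (Euc d) ℝ] {p : Euc d → ℝ} {ξ : Euc d → PiLp 2 (fun _ : Fin d => H)}
  {Q : Measure (Euc d)} [IsProbabilityMeasure Q]

omit [InnerProductSpace ℝ H] [CompleteSpace H] [RKHS ℝ H (Euc d) ℝ] in
lemma mem_unitBall_iff (f : Fin d → H) : f ∈ unitBall H ↔ ‖WithLp.toLp 2 f‖ ≤ 1 := by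
  rw [unitBall, Set.mem_ofPred_eq, ← sq_le_one_iff₀ (norm_nonneg _), PiLp.norm_sq_eq_of_L2]

omit [IsProbabilityMeasure Q] in
/-- The kernel Stein discrepancy is the norm of the mean embedding of the Stein feature. -/
lemma ksd_eq_enorm_integral (hξ : Integrable ξ Q)
    (hξf : ∀ (f : PiLp 2 (fun _ : Fin d => H)) x,
      inner ℝ (ξ x) f = langevinStein p (fun j => ⇑(f j)) x) :
    ksd H p Q = ‖∫ x, ξ x ∂Q‖ₑ := by
  set m := ∫ x, ξ x ∂Q
  have hint : ∀ f : Fin d → H,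
      ∫ x, langevinStein p (fun j => ⇑(f j)) x ∂Q = inner ℝ (WithLp.toLp 2 f) m := fun f => by
    rw [← integral_inner hξ]
    congr 1
    funext x
    rw [real_inner_comm, hξf]
  apply le_antisymm
  · refine iSup₂_le fun f hf => ?_
    rw [hint, enorm_le_iff_norm_le]
    refine (norm_inner_le_norm _ _).trans ?_
    exact mul_le_of_le_one_left (norm_nonneg _) ((mem_unitBall_iff f).1 hf)
  · rcases eq_or_ne m 0 with h0 | h0
    · rw [h0, enorm_zero]; exact zero_le
    have h1 : WithLp.toLp 2 (WithLp.ofLp (‖m‖⁻¹ • m)) = ‖m‖⁻¹ • m := rfl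
    -- The supremum is attained in the direction of the mean embedding itself.
    refine le_iSup₂_of_le (WithLp.ofLp (‖m‖⁻¹ • m)) ((mem_unitBall_iff _).2 ?_) ?_
    · rw [h1, norm_smul, norm_inv, norm_norm, inv_mul_cancel₀ (norm_ne_zero_iff.2 h0)]
    · rw [hint, h1, real_inner_smul_left, real_inner_self_eq_norm_sq, pow_two,
        inv_mul_cancel_left₀ (norm_ne_zero_iff.2 h0), enorm_norm]

omit [CompleteSpace H] [RKHS ℝ H (Euc d) ℝ] in
lemma ksdStat_eq_norm {k : Euc d → Euc d → ℝ}
    (hξk : ∀ x x', inner ℝ (ξ x) (ξ x') = steinKernel p k x x') {n : ℕ} (X : Fin n → Euc d) :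
    ksdStat p k X = ‖(n : ℝ)⁻¹ • ∑ i, ξ (X i)‖ := by
  rw [ksdStat, ← Real.sqrt_sq (norm_nonneg ((n : ℝ)⁻¹ • ∑ i, ξ (X i))), norm_smul, mul_pow,
    ← real_inner_self_eq_norm_sq (∑ i, ξ (X i)), sum_inner]
  simp_rw [inner_sum, hξk]
  simp

end Discrepancy

end RobustKSD

/-! ### Validity and consistency of the robust test -/

open RobustKSD MeasureTheory Filter Topology in
theorem mainTheorem8 {d : ℕ}
    -- the model `P`, with a positive `C^1` Lebesgue density `p`
    (P : MeasureTheory.ProbabilityMeasure (RobustKSD.Euc d)) (p : RobustKSD.Euc d → ℝ)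
    (hpC1 : ContDiff ℝ 1 p) (hpos : ∀ x, 0 < p x)
    (hP : (P : MeasureTheory.Measure (RobustKSD.Euc d)) =
      MeasureTheory.volume.withDensity (fun x => ENNReal.ofReal (p x)))
    -- the tilted kernel `k(x, x') = w(x) h(x - x') w(x')`
    (w h : RobustKSD.Euc d → ℝ)
    (hh : RobustKSD.IsCb2 h) (hhk : RobustKSD.IsReproducingKernel (fun x x' => h (x - x')))
    (hw : RobustKSD.IsCb1 w) (hws : ∃ C, ∀ x, ‖w x • RobustKSD.score p x‖ ≤ C)
    (k : RobustKSD.Euc d → RobustKSD.Euc d → ℝ) (hk : k = RobustKSD.tiltedKernel w h)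
    -- its reproducing kernel Hilbert space `H`
    (H : Type*) [NormedAddCommGroup H] [InnerProductSpace ℝ H] [CompleteSpace H]
    [RKHS ℝ H (RobustKSD.Euc d) ℝ] (hH : ∀ x x', RKHS.kernel H x x' (1 : ℝ) = k x x')
    -- the radius and the level
    (θ : ℝ) (hθ : 0 ≤ θ) (α : ℝ) (hα0 : 0 < α) (hα1 : α < 1) :
    -- the quantities involved are well defined: `τ_∞ < ∞`, and all expectations in `D(Q, P)` exist
    (BddAbove (Set.range fun x => RobustKSD.steinKernel p k x x) ∧
      ∀ Q : MeasureTheory.ProbabilityMeasure (RobustKSD.Euc d),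
        (∀ f ∈ RobustKSD.unitBall (d := d) H, MeasureTheory.Integrable
          (RobustKSD.langevinStein p (fun j => ⇑(f j)))
          (Q : MeasureTheory.Measure (RobustKSD.Euc d)))) ∧
    -- finite-sample validity, uniformly over the ball
    (∀ n : ℕ, 0 < n →
      (⨆ Q ∈ RobustKSD.ksdBall H p θ, RobustKSD.rejectionProb p k θ α n Q) ≤ ENNReal.ofReal α) ∧
    -- consistency outside the ball
    (∀ Q : MeasureTheory.ProbabilityMeasure (RobustKSD.Euc d), Q ∉ RobustKSD.ksdBall H p θ →
      Filter.Tendsto (fun n : ℕ => RobustKSD.rejectionProb p k θ α n Q)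
        Filter.atTop (nhds 1)) := by
  subst hk
  obtain ⟨ξ, hξ, ⟨C, hC⟩, hξf, hξk⟩ := exists_stein_feature (H := H) p hh hhk hw hws hH
  set k := tiltedKernel w h
  have hdiag : ∀ x, steinKernel p k x x = ‖ξ x‖ ^ 2 := fun x => by
    rw [← hξk, real_inner_self_eq_norm_sq]
  have hbdd : BddAbove (Set.range fun x => steinKernel p k x x) := by
    refine ⟨C ^ 2, ?_⟩
    rintro _ ⟨x, rfl⟩
    simp only [hdiag]
    gcongr
    exact hC x
  set τ := tauInf p k with hτdef
  have hle : ∀ x, ‖ξ x‖ ^ 2 ≤ τ := fun x => (hdiag x).symm.trans_le (le_ciSup hbdd x)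
  have hτ0 : 0 ≤ τ := (sq_nonneg _).trans (hle 0)
  have hτ : ∀ x, ‖ξ x‖ ≤ √τ := fun x => Real.le_sqrt_of_sq_le (hle x)
  have hint : ∀ Q : ProbabilityMeasure (Euc d), Integrable ξ (Q : Measure (Euc d)) := fun Q =>
    Integrable.of_bound hξ.aestronglyMeasurable C (Eventually.of_forall hC)
  have hball : ∀ Q : ProbabilityMeasure (Euc d),
      Q ∈ ksdBall H p θ ↔ ‖∫ x, ξ x ∂(Q : Measure (Euc d))‖ ≤ θ := fun Q => by
    rw [ksdBall, Set.mem_ofPred_eq, ksd_eq_enorm_integral (hint Q) hξf, ← ofReal_norm,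
      ENNReal.ofReal_le_ofReal_iff hθ]
  have hstat : ∀ {n : ℕ} (X : Fin n → Euc d), ksdStat p k X = ‖(n : ℝ)⁻¹ • ∑ i, ξ (X i)‖ :=
    fun X => ksdStat_eq_norm hξk X
  have hγ : ∀ n, 0 ≤ threshold p k α n := fun n => by unfold threshold; positivity
  refine ⟨⟨hbdd, fun Q f _ => ?_⟩, fun n hn => iSup₂_le fun Q hQ => ?_, fun Q hQ => ?_⟩
  · exact ((hint Q).inner_const (WithLp.toLp 2 f)).congr
      (Eventually.of_forall fun x => hξf (WithLp.toLp 2 f) x)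
  · refine le_trans (measure_mono fun X hX => ?_)
      (measure_lt_meanDeviation_le (μ := (Q : Measure (Euc d))) hξ hτ0 hτ hα0 hα1 hn)
    -- Since γ_n ≥ 0, rejection cannot come from the 0 in the maximum.
    have h1 : threshold p k α n < ksdStat p k X - θ :=
      (lt_max_iff.1 hX).resolve_left (hγ n).not_gt
    have h2 := norm_sub_norm_le ((n : ℝ)⁻¹ • ∑ i, ξ (X i)) (∫ x, ξ x ∂(Q : Measure (Euc d)))
    rw [hstat] at h1
    have h3 := (hball Q).1 hQ
    change threshold p k α n < ‖_‖
    linarith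
  · rw [hball, not_le] at hQ
    set m := ∫ x, ξ x ∂(Q : Measure (Euc d)) with hm
    -- Half of the gap absorbs γ_n for large n, the other half absorbs the deviation.
    set δ := (‖m‖ - θ) / 2 with hδdef
    have hδ : 0 < δ := by rw [hδdef]; linarith
    have hγ0 : Tendsto (fun n => threshold p k α n) atTop (𝓝 0) := by
      have h1 : ∀ c : ℝ, Tendsto (fun n : ℕ => √(c / n)) atTop (𝓝 0) := fun c => by
        simpa using (tendsto_const_div_atTop_nhds_zero_nat c).sqrt
      have h2 := (h1 τ).add (h1 (-2 * τ * Real.log α))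
      rwa [add_zero] at h2
    have hlow : Tendsto (fun n : ℕ => 1 - ENNReal.ofReal (τ / δ ^ 2 * (n : ℝ)⁻¹)) atTop (𝓝 1) := by
      have h1 := ENNReal.tendsto_ofReal
        ((tendsto_inv_atTop_nhds_zero_nat (𝕜 := ℝ)).const_mul (τ / δ ^ 2))
      simpa using ENNReal.Tendsto.sub tendsto_const_nhds h1 (Or.inl ENNReal.one_ne_top)
    refine tendsto_of_tendsto_of_tendsto_of_le_of_le' hlow tendsto_const_nhds ?_
      (Eventually.of_forall fun n => prob_le_one)
    filter_upwards [hγ0.eventually (gt_mem_nhds hδ), eventually_gt_atTop 0] with n hn hn0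
    rw [tsub_le_iff_right]
    -- Without rejection and with deviation below δ, the triangle inequality would give ‖m‖ - θ <
    -- 2δ, contradicting the choice of δ.
    have hcover : (Set.univ : Set (Fin n → Euc d)) ⊆
        {X | robustStat p k θ X > threshold p k α n} ∪
          {X | δ ≤ meanDeviation (Q : Measure (Euc d)) ξ X} := by
      intro X _
      by_contra hX
      simp only [Set.mem_union, Set.mem_ofPred_eq, not_or, not_lt, not_le] at hX
      have h1 : ksdStat p k X - θ ≤ threshold p k α n := (le_max_right _ _).trans hX.1
      have h2 := norm_sub_norm_le m ((n : ℝ)⁻¹ • ∑ i, ξ (X i))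
      rw [norm_sub_rev] at h2
      have h3 : ‖(n : ℝ)⁻¹ • ∑ i, ξ (X i) - m‖ < δ := hX.2
      rw [hstat] at h1
      linarith
    calc (1 : ENNReal) = (Measure.pi fun _ : Fin n => (Q : Measure (Euc d))) Set.univ :=
          measure_univ.symm
      _ ≤ _ := (measure_mono hcover).trans (measure_union_le _ _)
      _ ≤ _ := by
        gcongr
        · exact le_rfl
        · exact measure_le_meanDeviation_le hξ hτ0 hτ hδ hn0
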